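/- Let $\lambda$ be a partition of $n$, with Young diagram drawn in French notation (row $1$, the longest, at the bottom) and with columns numbered from left to right, and let $\lambda'_b$ be the length of column $b$. Let $\mathrm{Tab}(\lambda)$ be the set of all bijective fillings $T$ of the boxes of $\lambda$ with $1,\dots,n$ (no condition on rows or columns); $S_n$ acts on it by $\pi$ applied to every entry. Let $\mathrm{SYT}(\lambda)\subseteq\mathrm{Tab}(\lambda)$ be the set of standard Young tableaux (entries increasing along rows and up columns). For $T\in\mathrm{Tab}(\lambda)$ let $R(T),C(T)\subseteq S_n$ be the groups of permutations that send every number to a number in the same row, respectively the same column, of $T$, and put $$\varepsilon_T=\sum_{\tau\in C(T)}\sum_{\sigma\in R(T)}\mathrm{sgn}(\tau)\,\tau\sigma .$$ Let $S_n$ act on $\mathbb{C}[\mathbf{x},\mathbf{y}]=\mathbb{C}[x_1,\dots,x_n,y_1,\dots,y_n]$ diagonally by $x_i\mapsto x_{\pi(i)}$, $y_i\mapsto y_{\pi(i)}$. Fix an ordering of the boxes of $\lambda$, write $T_1,\dots,T_n$ for the entries of $T$ in these boxes, and for tuples $c=(c_1,\dots,c_n)$ and $d=(d_1,\dots,d_n)$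 of nonnegative integers put $$F_T^{c,d}=\varepsilon_T\bigl(x_{T_1}^{c_1}\cdots x_{T_n}^{c_n}\,y_{T_1}^{d_1}\cdots y_{T_n}^{d_n}\bigr),\qquad M_\lambda=\mathrm{span}_{\mathbb{C}}\{F_T^{c,d}:T\in\mathrm{Tab}(\lambda)\}.$$ For $T\in\mathrm{Tab}(\lambda)$, columns $a<b$ of $\lambda$ and a row index $1\le t\le\lambda'_b$, let $G_t^{a,b}=\sum_{\omega}\mathrm{sgn}(\omega)\,\omega$, where $\omega$ runs over the group of all permutations of the set of entries of $T$ that lie in column $a$ weakly above row $t$ or in column $b$ weakly below row $t$. Let $F_T=\prod(x_i-x_j)\in\mathbb{C}[x_1,\dots,x_n]$ be the ordinary Specht polynomial, the product being over all pairs $i,j$ in the same column of $T$ with $i$ above $j$, where $S_n$ acts by $x_i\mapsto x_{\pi(i)}$. Let $V_\lambda$ be the Specht module, that is, the $\mathbb{C}$-span of the polytabloids $e_T=\sum_{\tau\in C(T)}\mathrm{sgn}(\tau)\,\tau\{T\}$, $T\in\mathrm{Tab}(\lambda)$, in the complex permutation module on the tabloids $\{T\}$ of shape $\lambda$. Then for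 all $c$ and $d$: 1. $\pi F_T^{c,d}=F_{\pi T}^{c,d}$ for all $\pi\in S_n$ and $T\in\mathrm{Tab}(\lambda)$. 2. $G_t^{a,b}\bigl(F_T^{c,d}\bigr)=0$ for all $T\in\mathrm{Tab}(\lambda)$, all columns $a<b$ and all $1\le t\le\lambda'_b$. 3. $M_\lambda$ is spanned by the polynomials $F_T^{c,d}$ with $T\in\mathrm{SYT}(\lambda)$. 4. If the polynomials $F_T^{c,d}$, $T\in\mathrm{SYT}(\lambda)$, are linearly independent, then $M_\lambda\cong V_\lambda$ as $S_n$-modules. Moreover, there is then an $S_n$-equivariant linear isomorphism from $M_\lambda$ onto $\mathrm{span}_{\mathbb{C}}\{F_T:T\in\mathrm{Tab}(\lambda)\}$ that sends $F_T^{c,d}$ to $F_T$ for every $T\in\mathrm{Tab}(\lambda)$, and hence sends the basis $\{F_T^{c,d}:T\in\mathrm{SYT}(\lambda)\}$ of $M_\lambda$ to the basis $\{F_T:T\in\mathrm{SYT}(\lambda)\}$ of the target. -/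

import Mathlib

open Equiv (Perm)
open scoped MonoidAlgebra

/-! ### Tableaux

A partition is a `YoungDiagram`. A cell `(i, j)` lies in row `i` and column `j`, and row `0` is the
longest row. In French notation row `0` is the bottom row, so "above" means "larger row index".
The letters `1, …, n` are represented by `Fin n`. -/

/-- `Tab n lam`: the bijective fillings of the cells of `lam` with the `n` letters, with no condition
on rows and columns. -/
@[ext]
structure Tab (n : ℕ) (lam : YoungDiagram) where
  entry : {p // p ∈ lam.cells} ≃ Fin n

namespace Tab

variable {n : ℕ} {lam : YoungDiagram}

/-- The row of `T` that contains the letter `k`. -/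
def rowOf (T : Tab n lam) (k : Fin n) : ℕ := (T.entry.symm k).1.1

/-- The column of `T` that contains the letter `k`. -/
def colOf (T : Tab n lam) (k : Fin n) : ℕ := (T.entry.symm k).1.2

/-- The symmetric group acts on tableaux by applying a permutation to every entry. -/
instance : MulAction (Perm (Fin n)) (Tab n lam) where
  smul π T := ⟨T.entry.trans π⟩
  one_smul _ := rfl
  mul_smul _ _ _ := rfl

theorem rowOf_smul (π : Perm (Fin n)) (T : Tab n lam) (k : Fin n) :
    (π • T).rowOf k = T.rowOf (π⁻¹ k) := rfl

theorem colOf_smul (π : Perm (Fin n)) (T : Tab n lam) (k : Fin n) :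
    (π • T).colOf k = T.colOf (π⁻¹ k) := rfl

/-- Standard Young tableaux: the entries increase along rows and up columns. -/
def IsStandard (T : Tab n lam) : Prop :=
  (∀ p q : {p // p ∈ lam.cells}, p.1.1 = q.1.1 → p.1.2 < q.1.2 → T.entry p < T.entry q) ∧
  (∀ p q : {p // p ∈ lam.cells}, p.1.2 = q.1.2 → p.1.1 < q.1.1 → T.entry p < T.entry q)

/-- `R(T)`: the permutations that send every letter to a letter in the same row of `T`. -/
def rowGroup (T : Tab n lam) : Subgroup (Perm (Fin n)) where
  carrier := {σ | ∀ k, T.rowOf (σ k) = T.rowOf k}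
  one_mem' _ := rfl
  mul_mem' {a b} ha hb k := (ha (b k)).trans (hb k)
  inv_mem' {a} ha k := by simpa using (ha (a⁻¹ k)).symm

/-- `C(T)`: the permutations that send every letter to a letter in the same column of `T`. -/
def colGroup (T : Tab n lam) : Subgroup (Perm (Fin n)) where
  carrier := {τ | ∀ k, T.colOf (τ k) = T.colOf k}
  one_mem' _ := rfl
  mul_mem' {a b} ha hb k := (ha (b k)).trans (hb k)
  inv_mem' {a} ha k := by simpa using (ha (a⁻¹ k)).symm

end Tab

/-! ### Symmetrizers in the group algebra -/

section Symmetrizers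

variable {n : ℕ} {lam : YoungDiagram}

open Classical in
/-- `α(U) = ∑_{τ ∈ U} sgn(τ) τ`. -/
noncomputable def antisymmetrizer (U : Subgroup (Perm (Fin n))) : ℂ[Perm (Fin n)] :=
  ∑ τ : Perm (Fin n) with τ ∈ U, MonoidAlgebra.single τ (((Perm.sign τ : ℤˣ) : ℤ) : ℂ)

open Classical in
/-- `β(U) = ∑_{σ ∈ U} σ`. -/
noncomputable def symmetrizer (U : Subgroup (Perm (Fin n))) : ℂ[Perm (Fin n)] :=
  ∑ σ : Perm (Fin n) with σ ∈ U, MonoidAlgebra.single σ (1 : ℂ)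

/-- The Young symmetrizer
`ε_T = α(C(T)) β(R(T)) = ∑_{τ ∈ C(T)} ∑_{σ ∈ R(T)} sgn(τ) τ σ`. -/
noncomputable def youngSymmetrizer (T : Tab n lam) : ℂ[Perm (Fin n)] :=
  antisymmetrizer T.colGroup * symmetrizer T.rowGroup

/-- The letters of `T` that lie in column `a` weakly above row `t`, or in column `b` weakly below
row `t`. -/
def garnirSet (T : Tab n lam) (a b t : ℕ) : Set (Fin n) :=
  {k | (T.colOf k = a ∧ t ≤ T.rowOf k) ∨ (T.colOf k = b ∧ T.rowOf k ≤ t)}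

/-- The Garnir element: the antisymmetrizer of the group of permutations of `garnirSet T a b t`,
that is, of the permutations that fix every other letter. -/
noncomputable def garnirElement (T : Tab n lam) (a b t : ℕ) : ℂ[Perm (Fin n)] :=
  antisymmetrizer (fixingSubgroup (Perm (Fin n)) (garnirSet T a b t)ᶜ)

theorem conj_mem_rowGroup (π σ : Perm (Fin n)) (T : Tab n lam) :
    π * σ * π⁻¹ ∈ (π • T).rowGroup ↔ σ ∈ T.rowGroup := by
  change (∀ k, T.rowOf (π⁻¹ (π (σ (π⁻¹ k)))) = T.rowOf (π⁻¹ k)) ↔ ∀ k, T.rowOf (σ k) = T.rowOf k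
  constructor
  · intro h k
    simpa using h (π k)
  · intro h k
    simpa using h (π⁻¹ k)

theorem conj_mem_colGroup (π σ : Perm (Fin n)) (T : Tab n lam) :
    π * σ * π⁻¹ ∈ (π • T).colGroup ↔ σ ∈ T.colGroup := by
  change (∀ k, T.colOf (π⁻¹ (π (σ (π⁻¹ k)))) = T.colOf (π⁻¹ k)) ↔ ∀ k, T.colOf (σ k) = T.colOf k
  constructor
  · intro h k
    simpa using h (π k)
  · intro h k
    simpa using h (π⁻¹ k)

theorem single_mul_antisymmetrizer (π : Perm (Fin n)) (T : Tab n lam) :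
    MonoidAlgebra.single π (1 : ℂ) * antisymmetrizer T.colGroup =
      antisymmetrizer (π • T).colGroup * MonoidAlgebra.single π 1 := by
  classical
  unfold antisymmetrizer
  rw [Finset.mul_sum, Finset.sum_mul]
  refine Finset.sum_equiv (MulAut.conj π).toEquiv ?_ ?_
  · intro σ
    simp [conj_mem_colGroup]
  · intro σ _
    rcases Int.units_eq_one_or (Perm.sign π) with h | h <;>
      simp [MonoidAlgebra.single_mul_single, mul_assoc, h]

theorem single_mul_symmetrizer (π : Perm (Fin n)) (T : Tab n lam) :
    MonoidAlgebra.single π (1 : ℂ) * symmetrizer T.rowGroup =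
      symmetrizer (π • T).rowGroup * MonoidAlgebra.single π 1 := by
  classical
  unfold symmetrizer
  rw [Finset.mul_sum, Finset.sum_mul]
  refine Finset.sum_equiv (MulAut.conj π).toEquiv ?_ ?_
  · intro σ
    simp [conj_mem_rowGroup]
  · intro σ _
    simp [MonoidAlgebra.single_mul_single, mul_assoc]

theorem single_mul_youngSymmetrizer (π : Perm (Fin n)) (T : Tab n lam) :
    MonoidAlgebra.single π (1 : ℂ) * youngSymmetrizer T =
      youngSymmetrizer (π • T) * MonoidAlgebra.single π 1 := by
  unfold youngSymmetrizer
  rw [← mul_assoc, single_mul_antisymmetrizer, mul_assoc, single_mul_symmetrizer, mul_assoc]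

end Symmetrizers

/-- The subrepresentation spanned by a family of vectors indexed by the tableaux of shape `lam` and
permuted by the symmetric group in the same way as the tableaux. -/
def tabSpan {n : ℕ} {lam : YoungDiagram} {W : Type*} [AddCommGroup W] [Module ℂ W]
    (ρ : Representation ℂ (Perm (Fin n)) W) (v : Tab n lam → W)
    (hv : ∀ π T, ρ π (v T) = v (π • T)) : Subrepresentation ρ where
  toSubmodule := Submodule.span ℂ (Set.range v)
  apply_mem_toSubmodule π w hw := by
    have h : Submodule.span ℂ (Set.range v) ≤ (Submodule.span ℂ (Set.range v)).comap (ρ π) := by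
      rw [Submodule.span_le]
      rintro _ ⟨T, rfl⟩
      rw [SetLike.mem_coe, Submodule.mem_comap, hv]
      exact Submodule.subset_span ⟨_, rfl⟩
    exact h hw

/-! ### The polynomials in two sets of variables -/

section TwoSets

variable {n : ℕ} {lam : YoungDiagram}

/-- The diagonal action of the symmetric group on `ℂ[x_1, …, x_n, y_1, …, y_n]`: the permutation `π`
sends `x_i` to `x_{π(i)}` and `y_i` to `y_{π(i)}`. The variables `x_i` and `y_i` are
`X (Sum.inl i)` and `X (Sum.inr i)`. -/
noncomputable def diagonalRep (n : ℕ) :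
    Representation ℂ (Perm (Fin n)) (MvPolynomial (Fin n ⊕ Fin n) ℂ) where
  toFun π := (MvPolynomial.rename (R := ℂ) (Sum.map π π)).toLinearMap
  map_one' := by
    refine LinearMap.ext fun f => ?_
    simp
  map_mul' π ρ := by
    refine LinearMap.ext fun f => ?_
    simp [MvPolynomial.rename_rename, Function.comp_def, Sum.map_map]

/-- `x_T^c y_T^d = ∏_i x_{T_i}^{c_i} y_{T_i}^{d_i}`, where `sq` is an ordering of the cells of the
diagram and `T_i` is the entry of `T` in the `i`-th cell. -/
noncomputable def tabMonomial (sq : Fin n ≃ {p // p ∈ lam.cells}) (c d : Fin n → ℕ)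
    (T : Tab n lam) : MvPolynomial (Fin n ⊕ Fin n) ℂ :=
  (∏ i, MvPolynomial.X (Sum.inl (T.entry (sq i))) ^ c i) *
    ∏ i, MvPolynomial.X (Sum.inr (T.entry (sq i))) ^ d i

/-- `F_T^{c,d} = ε_T (x_T^c y_T^d)`. -/
noncomputable def higherSpecht (sq : Fin n ≃ {p // p ∈ lam.cells}) (c d : Fin n → ℕ)
    (T : Tab n lam) : MvPolynomial (Fin n ⊕ Fin n) ℂ :=
  (diagonalRep n).asAlgebraHom (youngSymmetrizer T) (tabMonomial sq c d T)

theorem diagonalRep_tabMonomial (sq : Fin n ≃ {p // p ∈ lam.cells}) (c d : Fin n → ℕ)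
    (π : Perm (Fin n)) (T : Tab n lam) :
    diagonalRep n π (tabMonomial sq c d T) = tabMonomial sq c d (π • T) := by
  change MvPolynomial.rename (Sum.map π π) (tabMonomial sq c d T) = _
  simp only [tabMonomial, map_mul, map_prod, map_pow, MvPolynomial.rename_X, Sum.map_inl,
    Sum.map_inr]
  rfl

theorem diagonalRep_higherSpecht (sq : Fin n ≃ {p // p ∈ lam.cells}) (c d : Fin n → ℕ)
    (π : Perm (Fin n)) (T : Tab n lam) :
    diagonalRep n π (higherSpecht sq c d T) = higherSpecht sq c d (π • T) := by
  have h := congrArg (fun z => (diagonalRep n).asAlgebraHom z (tabMonomial sq c d T))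
    (single_mul_youngSymmetrizer π T)
  simpa [higherSpecht, diagonalRep_tabMonomial] using h

/-- `M_λ`: the span of all `F_T^{c,d}`, where `T` runs over all tableaux of shape `lam`. -/
noncomputable def higherSpechtModule (sq : Fin n ≃ {p // p ∈ lam.cells}) (c d : Fin n → ℕ) :
    Subrepresentation (diagonalRep n) :=
  tabSpan (diagonalRep n) (higherSpecht sq c d) (diagonalRep_higherSpecht sq c d)

theorem higherSpecht_mem (sq : Fin n ≃ {p // p ∈ lam.cells}) (c d : Fin n → ℕ) (T : Tab n lam) :
    higherSpecht sq c d T ∈ (higherSpechtModule sq c d).toSubmodule :=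
  Submodule.subset_span ⟨T, rfl⟩

end TwoSets

/-! ### The ordinary Specht polynomials -/

section OneSet

variable {n : ℕ} {lam : YoungDiagram}

/-- The action of the symmetric group on `ℂ[x_1, …, x_n]` by permutation of the variables. -/
noncomputable def polyRep (n : ℕ) :
    Representation ℂ (Perm (Fin n)) (MvPolynomial (Fin n) ℂ) where
  toFun π := (MvPolynomial.rename (R := ℂ) π).toLinearMap
  map_one' := by
    refine LinearMap.ext fun f => ?_
    simp
  map_mul' π ρ := by
    refine LinearMap.ext fun f => ?_
    simp [MvPolynomial.rename_rename, Function.comp_def]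

/-- The ordinary Specht polynomial `F_T`: the product of `x_i - x_j` over all pairs of letters `i`,
`j` in the same column of `T` with `i` above `j`. -/
noncomputable def spechtPoly (T : Tab n lam) : MvPolynomial (Fin n) ℂ :=
  ∏ p : {p // p ∈ lam.cells},
    ∏ q : {p // p ∈ lam.cells} with q.1.2 = p.1.2 ∧ q.1.1 < p.1.1,
      (MvPolynomial.X (T.entry p) - MvPolynomial.X (T.entry q))

theorem polyRep_spechtPoly (π : Perm (Fin n)) (T : Tab n lam) :
    polyRep n π (spechtPoly T) = spechtPoly (π • T) := by
  change MvPolynomial.rename π (spechtPoly T) = _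
  simp only [spechtPoly, map_prod, map_sub, MvPolynomial.rename_X]
  rfl

/-- The span of the ordinary Specht polynomials of shape `lam`. -/
noncomputable def spechtPolyModule (n : ℕ) (lam : YoungDiagram) : Subrepresentation (polyRep n) :=
  tabSpan (polyRep n) (spechtPoly (lam := lam)) polyRep_spechtPoly

theorem spechtPoly_mem (T : Tab n lam) :
    spechtPoly T ∈ (spechtPolyModule n lam).toSubmodule :=
  Submodule.subset_span ⟨T, rfl⟩

end OneSet

/-! ### The Specht module -/

section Tabloids

variable {n : ℕ} {lam : YoungDiagram}

/-- Two tableaux are row equivalent if every letter lies in the same row of both. -/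
def rowSetoid (n : ℕ) (lam : YoungDiagram) : Setoid (Tab n lam) where
  r T T' := ∀ k, T.rowOf k = T'.rowOf k
  iseqv := ⟨fun _ _ => rfl, fun h k => (h k).symm, fun h h' k => (h k).trans (h' k)⟩

/-- Young tabloids of shape `lam`: classes of row equivalent tableaux. -/
def Tabloid (n : ℕ) (lam : YoungDiagram) : Type := Quotient (rowSetoid n lam)

/-- The tabloid `{T}` of a tableau `T`. -/
def Tab.tabloid (T : Tab n lam) : Tabloid n lam := Quotient.mk (rowSetoid n lam) T

/-- The symmetric group acts on tabloids by `π {T} = {π T}`. -/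
instance : MulAction (Perm (Fin n)) (Tabloid n lam) where
  smul π := Quotient.map (π • ·) fun _ _ h k => h (π⁻¹ k)
  one_smul := by
    rintro ⟨T⟩
    rfl
  mul_smul π ρ := by
    rintro ⟨T⟩
    rfl

theorem smul_tabloid (π : Perm (Fin n)) (T : Tab n lam) : π • T.tabloid = (π • T).tabloid := rfl

/-- The permutation module: the complex vector space `ℂ[Tabloid n lam]` with basis the tabloids of
shape `lam`, which are permuted by the symmetric group. -/
noncomputable abbrev tabloidRep (n : ℕ) (lam : YoungDiagram) :
    Representation ℂ (Perm (Fin n)) ℂ[Tabloid n lam] :=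
  Representation.ofMulAction ℂ (Perm (Fin n)) (Tabloid n lam)

/-- The polytabloid `e_T = ∑_{τ ∈ C(T)} sgn(τ) τ {T}`. -/
noncomputable def polytabloid (T : Tab n lam) : ℂ[Tabloid n lam] :=
  (tabloidRep n lam).asAlgebraHom (antisymmetrizer T.colGroup) (MonoidAlgebra.single T.tabloid 1)

theorem tabloidRep_polytabloid (π : Perm (Fin n)) (T : Tab n lam) :
    tabloidRep n lam π (polytabloid T) = polytabloid (π • T) := by
  have h := congrArg
    (fun z => (tabloidRep n lam).asAlgebraHom z (MonoidAlgebra.single T.tabloid 1))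
    (single_mul_antisymmetrizer π T)
  simpa [polytabloid, smul_tabloid] using h

/-- The Specht module `V_λ`: the span of the polytabloids of shape `lam`. -/
noncomputable def spechtModule (n : ℕ) (lam : YoungDiagram) :
    Subrepresentation (tabloidRep n lam) :=
  tabSpan (tabloidRep n lam) (polytabloid (lam := lam)) tabloidRep_polytabloid

end Tabloids

/-! ### Group-algebra identities and their action on representations. -/

section Symmetrizers

variable {n : ℕ} {lam : YoungDiagram} {W : Type*} [AddCommGroup W] [Module ℂ W]

/-! Everything is transported from polytabloids. The vector `β(R(T)) (x_T^c y_T^d)` is fixed by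
`R(T)` and moves with `T`, so it depends only on the tabloid `{T}`. This gives an equivariant map
from the permutation module to the polynomials, and since `ε_T = α(C(T)) β(R(T))` it sends `e_T` to
`F_T^{c,d}` (`exists_tabloid_map_higherSpecht`).

It therefore suffices to prove the Garnir relations (`garnirElement_polytabloid`, by pigeonhole) and
spanning by standard tableaux (`polytabloid_mem_span_standard`, by straightening) for polytabloids.
If the standard `F_T^{c,d}` are independent, the map is injective on `V_λ`, because the standard
polytabloids span `V_λ`; hence `V_λ ≅ M_λ`.

For Specht polynomials, send `{T}` to the monomial whose exponents are the row indices. Distinct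
tabloids give distinct monomials, so this map is injective, and `e_T` goes to a product of
Vandermonde determinants, which is `F_T` (`exists_tabloid_map_spechtPoly`). Composing the two
isomorphisms through `V_λ` gives the required map. -/

open Classical in
theorem asAlgebraHom_antisymmetrizer_apply (ρ : Representation ℂ (Perm (Fin n)) W)
    (U : Subgroup (Perm (Fin n))) (w : W) :
    ρ.asAlgebraHom (antisymmetrizer U) w =
      ∑ τ : Perm (Fin n) with τ ∈ U, (((Perm.sign τ : ℤˣ) : ℤ) : ℂ) • ρ τ w := by
  simp [antisymmetrizer, map_sum, LinearMap.sum_apply]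

theorem antisymmetrizer_mul_single {U : Subgroup (Perm (Fin n))} {s : Perm (Fin n)} (hs : s ∈ U) :
    antisymmetrizer U * MonoidAlgebra.single s 1 =
      (((Perm.sign s : ℤˣ) : ℤ) : ℂ) • antisymmetrizer U := by
  classical
  unfold antisymmetrizer
  rw [Finset.sum_mul, Finset.smul_sum]
  refine Finset.sum_equiv (Equiv.mulRight s) ?_ ?_
  · intro σ
    simp [U.mul_mem_cancel_right hs]
  · intro σ _
    rcases Int.units_eq_one_or (Perm.sign s) with h | h <;>
      simp [MonoidAlgebra.single_mul_single, h]

theorem single_mul_symmetrizer_of_mem {U : Subgroup (Perm (Fin n))} {s : Perm (Fin n)}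
    (hs : s ∈ U) :
    MonoidAlgebra.single s 1 * symmetrizer U = symmetrizer U := by
  classical
  unfold symmetrizer
  rw [Finset.mul_sum]
  refine Finset.sum_equiv (Equiv.mulLeft s) ?_ ?_
  · intro σ
    simp [U.mul_mem_cancel_left hs]
  · intro σ _
    simp [MonoidAlgebra.single_mul_single]

theorem asAlgebraHom_antisymmetrizer_apply_of_mem (ρ : Representation ℂ (Perm (Fin n)) W)
    {U : Subgroup (Perm (Fin n))} {s : Perm (Fin n)} (hs : s ∈ U) (w : W) :
    ρ.asAlgebraHom (antisymmetrizer U) (ρ s w) =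
      (((Perm.sign s : ℤˣ) : ℤ) : ℂ) • ρ.asAlgebraHom (antisymmetrizer U) w := by
  have h := congrArg (fun z => ρ.asAlgebraHom z w) (antisymmetrizer_mul_single hs)
  simpa using h

/-- An antisymmetrizer kills every vector that is fixed by a transposition of its group. -/
theorem asAlgebraHom_antisymmetrizer_eq_zero (ρ : Representation ℂ (Perm (Fin n)) W)
    {U : Subgroup (Perm (Fin n))} {x y : Fin n} (hxy : x ≠ y) (hs : Equiv.swap x y ∈ U) {w : W}
    (hw : ρ (Equiv.swap x y) w = w) :
    ρ.asAlgebraHom (antisymmetrizer U) w = 0 := by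
  have h := asAlgebraHom_antisymmetrizer_apply_of_mem ρ hs w
  rw [hw, Perm.sign_swap hxy] at h
  have h2 : ρ.asAlgebraHom (antisymmetrizer U) w = -ρ.asAlgebraHom (antisymmetrizer U) w := by
    simpa using h
  have h3 : (2 : ℂ) • ρ.asAlgebraHom (antisymmetrizer U) w = 0 := by
    rw [two_smul]
    nth_rewrite 1 [h2]
    simp
  simpa using h3

/-- Equivariance extends linearly to the group algebra; this is how Garnir relations and
antisymmetrizers pass between representations. -/
theorem map_asAlgebraHom_apply {W' : Type*} [AddCommGroup W'] [Module ℂ W']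
    {ρ : Representation ℂ (Perm (Fin n)) W} {ρ' : Representation ℂ (Perm (Fin n)) W'}
    {f : W →ₗ[ℂ] W'} (hf : ∀ π w, f (ρ π w) = ρ' π (f w)) (z : ℂ[Perm (Fin n)]) (w : W) :
    f (ρ.asAlgebraHom z w) = ρ'.asAlgebraHom z (f w) := by
  induction z using MonoidAlgebra.induction_linear with
  | zero => simp
  | add x y hx hy => simp [hx, hy]
  | single g r => simp [hf]

end Symmetrizers

/-! ### Equivariant maps out of the permutation module on tabloids. -/

section TabloidLift

variable {n : ℕ} {lam : YoungDiagram} {W : Type*} [AddCommGroup W] [Module ℂ W]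

theorem Tab.exists_smul_eq (T T' : Tab n lam) : ∃ π : Perm (Fin n), π • T = T' := by
  refine ⟨T.entry.symm.trans T'.entry, ?_⟩
  ext p
  change (((T.entry.symm.trans T'.entry) (T.entry p) : Fin n) : ℕ) = _
  simp

/-- A family of vectors on which the row groups act trivially only depends on the tabloids. -/
theorem eq_of_rowOf_eq {ρ : Representation ℂ (Perm (Fin n)) W} {w : Tab n lam → W}
    (hw : ∀ π T, ρ π (w T) = w (π • T)) (hrow : ∀ T, ∀ σ ∈ T.rowGroup, ρ σ (w T) = w T)
    {T T' : Tab n lam} (h : ∀ k, T.rowOf k = T'.rowOf k) : w T = w T' := by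
  obtain ⟨π, rfl⟩ := T.exists_smul_eq T'
  rw [← hw, hrow]
  intro k
  simpa [Tab.rowOf_smul] using h (π k)

/-- The linear map on the permutation module that is given by its values on the tabloids. -/
noncomputable def tabloidLift (w : Tabloid n lam → W) : ℂ[Tabloid n lam] →ₗ[ℂ] W :=
  Finsupp.linearCombination ℂ w ∘ₗ (MonoidAlgebra.coeffLinearEquiv ℂ).toLinearMap

@[simp]
theorem tabloidLift_single (w : Tabloid n lam → W) (t : Tabloid n lam) (r : ℂ) :
    tabloidLift w (MonoidAlgebra.single t r) = r • w t := by
  simp [tabloidLift]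

theorem tabloidLift_injective {w : Tabloid n lam → W} (hw : LinearIndependent ℂ w) :
    Function.Injective (tabloidLift w) := by
  have h : Function.Injective (Finsupp.linearCombination ℂ w) := hw
  exact h.comp (MonoidAlgebra.coeffLinearEquiv ℂ).injective

theorem tabloidLift_tabloidRep {ρ : Representation ℂ (Perm (Fin n)) W} {w : Tabloid n lam → W}
    (hw : ∀ (π : Perm (Fin n)) t, ρ π (w t) = w (π • t)) (π : Perm (Fin n))
    (x : ℂ[Tabloid n lam]) :
    tabloidLift w (tabloidRep n lam π x) = ρ π (tabloidLift w x) := by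
  induction x using MonoidAlgebra.induction_linear with
  | zero => simp
  | add x y hx hy => simp [hx, hy]
  | single t r => simp [hw]

/-- Every equivariant family of vectors on which the row groups act trivially is the image of the
tabloids under an equivariant map. -/
theorem exists_tabloid_map {ρ : Representation ℂ (Perm (Fin n)) W} {w : Tab n lam → W}
    (hw : ∀ π T, ρ π (w T) = w (π • T)) (hrow : ∀ T, ∀ σ ∈ T.rowGroup, ρ σ (w T) = w T) :
    ∃ f : ℂ[Tabloid n lam] →ₗ[ℂ] W, (∀ π x, f (tabloidRep n lam π x) = ρ π (f x)) ∧
      ∀ T, f (polytabloid T) = ρ.asAlgebraHom (antisymmetrizer T.colGroup) (w T) := by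
  let w' : Tabloid n lam → W := Quotient.lift w fun _ _ h => eq_of_rowOf_eq hw hrow h
  have hw' : ∀ (π : Perm (Fin n)) t, ρ π (w' t) = w' (π • t) := by
    rintro π ⟨T⟩
    exact hw π T
  refine ⟨tabloidLift w', tabloidLift_tabloidRep hw', fun T => ?_⟩
  rw [polytabloid, map_asAlgebraHom_apply (tabloidLift_tabloidRep hw'), tabloidLift_single,
    one_smul]
  rfl

/-- The row symmetrizer is absorbed into the image of the tabloid, which makes that image well
defined; the column antisymmetrizer then comes from the polytabloid. -/
theorem exists_tabloid_map_higherSpecht (sq : Fin n ≃ {p // p ∈ lam.cells}) (c d : Fin n → ℕ) :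
    ∃ f : ℂ[Tabloid n lam] →ₗ[ℂ] MvPolynomial (Fin n ⊕ Fin n) ℂ,
      (∀ π x, f (tabloidRep n lam π x) = diagonalRep n π (f x)) ∧
      ∀ T, f (polytabloid T) = higherSpecht sq c d T := by
  obtain ⟨f, hf, hfe⟩ := exists_tabloid_map (lam := lam) (ρ := diagonalRep n)
    (w := fun T => (diagonalRep n).asAlgebraHom (symmetrizer T.rowGroup) (tabMonomial sq c d T))
    (fun π T => by
      have h := congrArg (fun z => (diagonalRep n).asAlgebraHom z (tabMonomial sq c d T))
        (single_mul_symmetrizer π T)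
      simpa [diagonalRep_tabMonomial] using h)
    (fun T σ hσ => by
      have h := congrArg (fun z => (diagonalRep n).asAlgebraHom z (tabMonomial sq c d T))
        (single_mul_symmetrizer_of_mem hσ)
      simpa using h)
  refine ⟨f, hf, fun T => ?_⟩
  rw [hfe, higherSpecht, youngSymmetrizer, map_mul, Module.End.mul_apply]

end TabloidLift

/-! ### Garnir relations for polytabloids. -/

section Garnir

variable {n : ℕ} {lam : YoungDiagram}

theorem Tab.colOf_smul_of_mem_colGroup {T : Tab n lam} {τ : Perm (Fin n)} (hτ : τ ∈ T.colGroup)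
    (k : Fin n) : (τ • T).colOf k = T.colOf k := by
  rw [Tab.colOf_smul]
  exact T.colGroup.inv_mem hτ k

theorem Tab.exists_rowOf_colOf (T : Tab n lam) {i j : ℕ} (h : (i, j) ∈ lam) :
    ∃ k, T.rowOf k = i ∧ T.colOf k = j :=
  ⟨T.entry ⟨(i, j), h⟩, by simp [Tab.rowOf], by simp [Tab.colOf]⟩

theorem Tab.rowOf_colOf_mem (T : Tab n lam) (k : Fin n) : (T.rowOf k, T.colOf k) ∈ lam :=
  (T.entry.symm k).2

theorem Tab.ext_rowOf_colOf (T : Tab n lam) {k l : Fin n} (hr : T.rowOf k = T.rowOf l)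
    (hc : T.colOf k = T.colOf l) : k = l :=
  T.entry.symm.injective (Subtype.ext (Prod.ext hr hc))

/-- Pigeonhole principle: a Garnir set has more letters than there are rows for them. -/
theorem exists_rowOf_eq_of_garnirSet (T T' : Tab n lam) (hT' : ∀ k, T'.colOf k = T.colOf k)
    {a b t : ℕ} (hab : a < b) (ht : (t, b) ∈ lam) :
    ∃ x ∈ garnirSet T a b t, ∃ y ∈ garnirSet T a b t, x ≠ y ∧ T'.rowOf x = T'.rowOf y := by
  have hta : t < lam.colLen a :=
    YoungDiagram.mem_iff_lt_colLen.1 (lam.up_left_mem le_rfl hab.le ht)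
  -- List the Garnir letters from bottom to top: rows `0, …, t` of column `b`, then rows `t, …` of
  -- column `a`. Row `t` is used twice, which gives one letter more than the length of column `a`.
  have key : ∀ i : Fin (lam.colLen a + 1), ∃ k ∈ garnirSet T a b t,
      (T.rowOf k, T.colOf k) = if i.1 ≤ t then (i.1, b) else (i.1 - 1, a) := by
    intro i
    split_ifs with hi
    · obtain ⟨k, hr, hc⟩ := T.exists_rowOf_colOf (lam.up_left_mem hi le_rfl ht)
      exact ⟨k, Or.inr ⟨hc, hr ▸ hi⟩, by rw [hr, hc]⟩
    · obtain ⟨k, hr, hc⟩ := T.exists_rowOf_colOf (i := i.1 - 1) (j := a)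
        (YoungDiagram.mem_iff_lt_colLen.2 (by omega))
      exact ⟨k, Or.inl ⟨hc, by omega⟩, by rw [hr, hc]⟩
  choose g hg hgi using key
  have hginj : Function.Injective g := by
    intro i j hij
    have h := (hgi i).symm.trans (hij ▸ hgi j)
    split_ifs at h with h1 h2 h2 <;> simp only [Prod.mk.injEq] at h <;> omega
  -- In `T'` these letters still lie in columns weakly right of `a`, which are no longer than column
  -- `a`, so only `lam.colLen a` rows are available.
  obtain ⟨i, -, j, -, hij, h⟩ := Finset.exists_ne_map_eq_of_card_lt_of_maps_to
    (s := (Finset.univ : Finset (Fin (lam.colLen a + 1)))) (t := Finset.range (lam.colLen a))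
    (f := fun i => T'.rowOf (g i)) (by simp) (by
      intro i _
      have h1 := T'.rowOf_colOf_mem (g i)
      have h2 : a ≤ T'.colOf (g i) := by
        rw [hT']
        rcases hg i with h | h
        · exact h.1.ge
        · exact h.1 ▸ hab.le
      simpa using YoungDiagram.mem_iff_lt_colLen.1 (lam.up_left_mem le_rfl h2 h1))
  exact ⟨g i, hg i, g j, hg j, fun e => hij (hginj e), h⟩

theorem swap_mem_fixingSubgroup {s : Set (Fin n)} {x y : Fin n} (hx : x ∈ s) (hy : y ∈ s) :
    Equiv.swap x y ∈ fixingSubgroup (Perm (Fin n)) sᶜ := by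
  rw [mem_fixingSubgroup_iff]
  intro k hk
  exact Equiv.swap_apply_of_ne_of_ne (fun h => hk (h ▸ hx)) (fun h => hk (h ▸ hy))

theorem swap_smul_tabloid {T : Tab n lam} {x y : Fin n} (h : T.rowOf x = T.rowOf y) :
    Equiv.swap x y • T.tabloid = T.tabloid := by
  refine Quotient.sound (s := rowSetoid n lam) fun k => ?_
  rw [Tab.rowOf_smul, Equiv.swap_inv]
  rcases eq_or_ne k x with rfl | hx
  · rw [Equiv.swap_apply_left, h]
  rcases eq_or_ne k y with rfl | hy
  · rw [Equiv.swap_apply_right, h]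
  · rw [Equiv.swap_apply_of_ne_of_ne hx hy]

/-- Each term `τ{T}` is killed separately: two Garnir letters share a row of `τT`, and their
transposition fixes the tabloid but lies in the Garnir group. -/
theorem garnirElement_polytabloid (T : Tab n lam) {a b t : ℕ} (hab : a < b) (ht : (t, b) ∈ lam) :
    (tabloidRep n lam).asAlgebraHom (garnirElement T a b t) (polytabloid T) = 0 := by
  classical
  rw [polytabloid, asAlgebraHom_antisymmetrizer_apply, map_sum]
  refine Finset.sum_eq_zero fun τ hτ => ?_
  have hτ' : τ ∈ T.colGroup := by simpa using hτ
  obtain ⟨x, hx, y, hy, hxy, h⟩ := exists_rowOf_eq_of_garnirSet T (τ • T)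
    (Tab.colOf_smul_of_mem_colGroup hτ') hab ht
  rw [map_smul, garnirElement, asAlgebraHom_antisymmetrizer_eq_zero (tabloidRep n lam) hxy
    (swap_mem_fixingSubgroup hx hy), smul_zero]
  rw [Representation.ofMulAction_single, Representation.ofMulAction_single, smul_tabloid,
    swap_smul_tabloid h]

theorem polytabloid_smul_of_mem_colGroup {T : Tab n lam} {τ : Perm (Fin n)}
    (hτ : τ ∈ T.colGroup) :
    polytabloid (τ • T) = (((Perm.sign τ : ℤˣ) : ℤ) : ℂ) • polytabloid T := by
  have h : (τ • T).colGroup = T.colGroup := by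
    ext σ
    change (∀ k, _ = _) ↔ ∀ k, _ = _
    simp only [Tab.colOf_smul_of_mem_colGroup hτ]
  rw [polytabloid, h, ← smul_tabloid, ← Representation.ofMulAction_single,
    asAlgebraHom_antisymmetrizer_apply_of_mem _ hτ, polytabloid]

end Garnir

/-! ### Straightening: standard polytabloids span. -/

section Straightening

variable {n : ℕ} {lam : YoungDiagram}

instance : Finite (Tab n lam) :=
  Finite.of_injective Tab.entry fun _ _ => Tab.ext

/-- The sum of all letters, each weighted by the number of its column. -/
def Tab.colWeight (T : Tab n lam) : ℕ := ∑ k : Fin n, (k : ℕ) * T.colOf k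

/-- The sum of all letters, each weighted by the number of its row. -/
def Tab.rowWeight (T : Tab n lam) : ℕ := ∑ k : Fin n, (k : ℕ) * T.rowOf k

theorem sum_mul_lt_sum_mul_swap {f : Fin n → ℕ} {x y : Fin n} (hxy : y < x) (hf : f x < f y) :
    ∑ k : Fin n, (k : ℕ) * f k < ∑ k : Fin n, (k : ℕ) * f (Equiv.swap x y k) := by
  classical
  have hne : x ≠ y := hxy.ne'
  rw [← Finset.sum_add_sum_compl {x, y},
    ← Finset.sum_add_sum_compl {x, y} (fun k : Fin n => _ * f (Equiv.swap x y k)),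
    Finset.sum_pair hne, Finset.sum_pair hne, Equiv.swap_apply_left, Equiv.swap_apply_right]
  -- Only the terms at `x` and `y` change, and the gain is `(x - y) * (f y - f x) > 0`.
  refine add_lt_add_of_lt_of_le ?_ (Finset.sum_congr rfl fun k hk => ?_).le
  · have h : (y : ℕ) < x := hxy
    nlinarith
  · simp only [Finset.mem_compl, Finset.mem_insert, Finset.mem_singleton, not_or] at hk
    rw [Equiv.swap_apply_of_ne_of_ne hk.1 hk.2]

/-- A Garnir permutation at a row descent that does not preserve the columns moves larger letters
to the right. -/
theorem Tab.colWeight_lt_smul (T : Tab n lam) {a b t : ℕ} (hab : a < b)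
    (hdesc : ∀ x y, T.colOf x = a → t ≤ T.rowOf x → T.colOf y = b → T.rowOf y ≤ t → y < x)
    {ω : Perm (Fin n)} (hω : ω ∈ fixingSubgroup (Perm (Fin n)) (garnirSet T a b t)ᶜ)
    (hcol : ω ∉ T.colGroup) : T.colWeight < (ω • T).colWeight := by
  classical
  let s : Finset (Fin n) := {k | k ∈ garnirSet T a b t}
  have hs : ∀ k, k ∈ s ↔ k ∈ garnirSet T a b t := fun k => by simp [s]
  have hfix : ∀ k, k ∉ garnirSet T a b t → ω⁻¹ k = k := by
    have h := (fixingSubgroup (Perm (Fin n)) (garnirSet T a b t)ᶜ).inv_mem hω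
    rw [mem_fixingSubgroup_iff] at h
    exact fun k hk => h k hk
  have hmaps : ∀ k ∈ garnirSet T a b t, ω⁻¹ k ∈ garnirSet T a b t := by
    intro k hk
    by_contra h
    exact h ((ω⁻¹.injective (hfix _ h)).symm ▸ hk)
  -- Every Garnir letter in column `a` exceeds every one in column `b`, so the present arrangement
  -- minimizes the weight by the rearrangement inequality. It remains to exclude equality.
  have hanti : AntivaryOn (fun k : Fin n => (k : ℕ)) T.colOf s := by
    intro x hx y hy hlt
    have hx := (hs x).1 hx
    have hy := (hs y).1 hy
    rcases hx with hx | hx <;> rcases hy with hy | hy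
    · omega
    · exact (hdesc x y hx.1 hx.2 hy.1 hy.2).le
    · omega
    · omega
  have hsub : {x | ω⁻¹ x ≠ x} ⊆ (s : Set (Fin n)) := by
    intro k hk
    by_contra h
    exact hk (hfix k fun h' => h ((hs k).2 h'))
  have hlt : ∑ k ∈ s, (k : ℕ) * T.colOf k < ∑ k ∈ s, (k : ℕ) * T.colOf (ω⁻¹ k) := by
    rw [hanti.sum_mul_lt_sum_mul_comp_perm_iff hsub]
    intro hva
    have hgar : ∀ k ∈ garnirSet T a b t, T.colOf k = a ∨ T.colOf k = b := fun k hk =>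
      hk.imp And.left And.left
    -- If no Garnir letter left column `e`, then by finiteness `ω⁻¹` would permute those of column
    -- `e`, hence also those of the other column, and `ω` would preserve all columns.
    have hmove : ∀ e, e = a ∨ e = b →
        ∃ y ∈ garnirSet T a b t, T.colOf y = e ∧ T.colOf (ω⁻¹ y) ≠ e := by
      intro e he
      by_contra! hno
      have hbij := ((Set.toFinite _).injOn_iff_bijOn_of_mapsTo
        (s := {k | k ∈ garnirSet T a b t ∧ T.colOf k = e}) (f := ⇑ω⁻¹)
        fun k hk => ⟨hmaps k hk.1, hno k hk.1 hk.2⟩).1 ω⁻¹.injective.injOn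
      refine hcol (inv_mem_iff.1 (show ω⁻¹ ∈ T.colGroup from fun k => ?_))
      by_cases hk : k ∈ garnirSet T a b t
      · by_cases hke : T.colOf k = e
        · rw [hno k hk hke, hke]
        · have hke' : T.colOf (ω⁻¹ k) ≠ e := by
            intro h
            obtain ⟨l, hl, hlk⟩ := hbij.surjOn ⟨hmaps k hk, h⟩
            exact hke (ω⁻¹.injective hlk ▸ hl.2)
          have h1 := hgar k hk
          have h2 := hgar _ (hmaps k hk)
          omega
      · rw [hfix k hk]
    obtain ⟨y, hy, hyb, hya⟩ := hmove b (Or.inr rfl)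
    obtain ⟨x, hx, hxa, hxb⟩ := hmove a (Or.inl rfl)
    replace hya := (hgar _ (hmaps y hy)).resolve_right hya
    replace hxb := (hgar _ (hmaps x hx)).resolve_left hxb
    -- After rearranging, `y` carries weight `a` and `x` carries weight `b > a`. Equality would
    -- force `x ≤ y`, against the descent.
    have hlt := hva ((hs y).2 hy) ((hs x).2 hx) (by
      rw [Function.comp_apply, Function.comp_apply, hya, hxb]
      exact hab)
    have hlt' : y < x := by
      rcases hx with hx | hx
      · rcases hy with hy | hy
        · omega
        · exact hdesc x y hx.1 hx.2 hy.1 hy.2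
      · omega
    exact absurd hlt (not_le.2 hlt')
  unfold Tab.colWeight
  simp only [Tab.colOf_smul]
  rw [← Finset.sum_add_sum_compl s, ← Finset.sum_add_sum_compl s (fun k => _ * T.colOf (ω⁻¹ k))]
  refine add_lt_add_of_lt_of_le hlt (Finset.sum_congr rfl fun k hk => ?_).le
  rw [hfix k]
  intro h
  exact (Finset.mem_compl.1 hk) ((hs k).2 h)

theorem Tab.swap_mem_colGroup {T : Tab n lam} {x y : Fin n} (h : T.colOf x = T.colOf y) :
    Equiv.swap x y ∈ T.colGroup := by
  intro k
  rcases eq_or_ne k x with rfl | hx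
  · rw [Equiv.swap_apply_left, h]
  rcases eq_or_ne k y with rfl | hy
  · rw [Equiv.swap_apply_right, h]
  · rw [Equiv.swap_apply_of_ne_of_ne hx hy]

theorem Tab.colWeight_smul_of_mem_colGroup {T : Tab n lam} {τ : Perm (Fin n)}
    (hτ : τ ∈ T.colGroup) : (τ • T).colWeight = T.colWeight := by
  unfold Tab.colWeight
  simp only [Tab.colOf_smul_of_mem_colGroup hτ]

/-- A polytabloid lies in a submodule if all Garnir permutations that do not preserve the columns
send it to that submodule. -/
theorem polytabloid_mem_of_garnir {N : Submodule ℂ ℂ[Tabloid n lam]} (T : Tab n lam) {a b t : ℕ}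
    (hab : a < b) (ht : (t, b) ∈ lam)
    (h : ∀ ω ∈ fixingSubgroup (Perm (Fin n)) (garnirSet T a b t)ᶜ, ω ∉ T.colGroup →
      polytabloid (ω • T) ∈ N) : polytabloid T ∈ N := by
  classical
  have hz := garnirElement_polytabloid T hab ht
  rw [garnirElement, asAlgebraHom_antisymmetrizer_apply,
    ← Finset.sum_filter_add_sum_filter_not _ (fun ω => ω ∈ T.colGroup)] at hz
  simp only [tabloidRep_polytabloid] at hz
  -- A column-preserving `ω` contributes `sgn(ω)² e_T = e_T`, so the Garnir relation expresses a
  -- multiple of `e_T` by the other terms; the multiple is nonzero because `ω = 1` is counted.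
  have h1 : ∀ ω ∈ ({ω : Perm (Fin n) |
        ω ∈ fixingSubgroup (Perm (Fin n)) (garnirSet T a b t)ᶜ} : Finset _).filter
        (fun ω => ω ∈ T.colGroup),
      (((Perm.sign ω : ℤˣ) : ℤ) : ℂ) • polytabloid (ω • T) = polytabloid T := by
    intro ω hω
    rw [polytabloid_smul_of_mem_colGroup (Finset.mem_filter.1 hω).2, smul_smul]
    rcases Int.units_eq_one_or (Perm.sign ω) with h | h <;> simp [h]
  rw [Finset.sum_congr rfl h1, Finset.sum_const, ← Nat.cast_smul_eq_nsmul ℂ] at hz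
  have hcard : (Finset.card (({ω : Perm (Fin n) |
        ω ∈ fixingSubgroup (Perm (Fin n)) (garnirSet T a b t)ᶜ} : Finset _).filter
        (fun ω => ω ∈ T.colGroup)) : ℂ) ≠ 0 := by
    rw [Nat.cast_ne_zero]
    refine Finset.card_ne_zero_of_mem (a := 1) ?_
    simp [one_mem]
  rw [← N.smul_mem_iff hcard, eq_neg_of_add_eq_zero_left hz]
  refine N.neg_mem (N.sum_mem fun ω hω => N.smul_mem _ ?_)
  rw [Finset.mem_filter, Finset.mem_filter] at hω
  exact h ω hω.1.2 hω.2

/-- The straightening algorithm: the standard polytabloids span the Specht module. -/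
theorem polytabloid_mem_span_standard (T : Tab n lam) :
    polytabloid T ∈ Submodule.span ℂ
      (Set.range fun T : {T : Tab n lam // T.IsStandard} => polytabloid T.1) := by
  by_contra hT
  -- Take a counterexample maximal for the lexicographic order. Sorting a column keeps the column
  -- weight and raises the row weight; a Garnir move raises the column weight.
  obtain ⟨T, hT, hmax⟩ := Set.exists_max_image
    {T : Tab n lam | polytabloid T ∉ Submodule.span ℂ
      (Set.range fun T : {T : Tab n lam // T.IsStandard} => polytabloid T.1)}
    (fun T => toLex (T.colWeight, T.rowWeight)) (Set.toFinite _) ⟨T, hT⟩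
  replace hmax : ∀ T' : Tab n lam, toLex (T.colWeight, T.rowWeight) <
      toLex (T'.colWeight, T'.rowWeight) → polytabloid T' ∈ Submodule.span ℂ
      (Set.range fun T : {T : Tab n lam // T.IsStandard} => polytabloid T.1) := by
    intro T' hlt
    by_contra h
    exact absurd (hmax T' h) (not_le.2 hlt)
  refine hT (Submodule.subset_span ⟨⟨T, ?_⟩, rfl⟩)
  have hrc : ∀ p, T.rowOf (T.entry p) = p.1.1 ∧ T.colOf (T.entry p) = p.1.2 := by
    intro p
    simp [Tab.rowOf, Tab.colOf]
  have hcol : ∀ x y, T.colOf x = T.colOf y → T.rowOf x < T.rowOf y → x < y := by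
    intro x y hc hr
    by_contra hxy
    have hxy' : y < x := lt_of_le_of_ne (not_lt.1 hxy) fun h => by simp [h] at hr
    have hs := Tab.swap_mem_colGroup hc
    have hmem := hmax (Equiv.swap x y • T) (by
      rw [Prod.Lex.toLex_lt_toLex]
      refine Or.inr ⟨(Tab.colWeight_smul_of_mem_colGroup hs).symm, ?_⟩
      simpa [Tab.rowWeight, Tab.rowOf_smul] using sum_mul_lt_sum_mul_swap hxy' hr)
    rw [polytabloid_smul_of_mem_colGroup hs, Submodule.smul_mem_iff _ (by simp)] at hmem
    exact hT hmem
  refine ⟨fun p q h1 h2 => ?_, fun p q h1 h2 => hcol _ _ ?_ ?_⟩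
  · by_contra hpq
    -- Apply Garnir at the row descent `p`, `q`. As columns increase upwards, Garnir letters in the
    -- left column are at least `T.entry p` and those in the right column at most `T.entry q`.
    refine hT (polytabloid_mem_of_garnir T (t := p.1.1) h2 (h1 ▸ q.2) fun ω hω hωc =>
      hmax _ (Prod.Lex.toLex_lt_toLex.2 (Or.inl (T.colWeight_lt_smul h2 ?_ hω hωc))))
    intro x y hxa hxr hyb hyr
    have hpx : T.entry p ≤ x := by
      rcases hxr.eq_or_lt with h | h
      · exact (T.ext_rowOf_colOf ((hrc p).1.trans h) ((hrc p).2.trans hxa.symm)).le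
      · exact (hcol _ _ ((hrc p).2.trans hxa.symm) (by rwa [(hrc p).1])).le
    have hyq : y ≤ T.entry q := by
      rcases hyr.eq_or_lt with h | h
      · exact (T.ext_rowOf_colOf (h.trans (h1.trans (hrc q).1.symm)) (hyb.trans (hrc q).2.symm)).le
      · exact (hcol _ _ (hyb.trans (hrc q).2.symm) (by rw [(hrc q).1]; omega)).le
    have hne : T.entry p ≠ T.entry q := fun h => by
      rw [T.entry.injective h] at h2
      exact lt_irrefl _ h2
    exact hyq.trans_lt ((lt_of_le_of_ne (not_lt.1 hpq) hne.symm).trans_le hpx)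
  · rw [(hrc p).2, (hrc q).2, h1]
  · rw [(hrc p).1, (hrc q).1]
    exact h2

end Straightening

/-! ### Specht polynomials as Vandermonde products. -/

section SpechtPoly

variable {n : ℕ} {lam : YoungDiagram}

/-- The monomial `∏ x_k ^ r(k)`, where `r(k)` is the row of `T` that contains `k`. -/
noncomputable def rowMonomial (T : Tab n lam) : MvPolynomial (Fin n) ℂ :=
  ∏ k, MvPolynomial.X k ^ T.rowOf k

theorem polyRep_rowMonomial (π : Perm (Fin n)) (T : Tab n lam) :
    polyRep n π (rowMonomial T) = rowMonomial (π • T) := by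
  change MvPolynomial.rename π (rowMonomial T) = _
  simp only [rowMonomial, map_prod, map_pow, MvPolynomial.rename_X]
  refine Fintype.prod_equiv π _ _ fun k => ?_
  simp [Tab.rowOf_smul]

/-- The block diagonal matrix with one Vandermonde block for every column of `T`. -/
noncomputable def columnMatrix (T : Tab n lam) : Matrix (Fin n) (Fin n) (MvPolynomial (Fin n) ℂ) :=
  Matrix.of fun k l => if T.colOf k = T.colOf l then MvPolynomial.X k ^ T.rowOf l else 0

/-- This is the Leibniz expansion: a permutation outside `C(T)` picks a zero entry off the column
blocks. -/
theorem asAlgebraHom_antisymmetrizer_rowMonomial (T : Tab n lam) :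
    (polyRep n).asAlgebraHom (antisymmetrizer T.colGroup) (rowMonomial T) =
      (columnMatrix T).det := by
  classical
  rw [asAlgebraHom_antisymmetrizer_apply, Matrix.det_apply, Finset.sum_filter]
  refine Finset.sum_congr rfl fun τ _ => ?_
  split_ifs with hτ
  · have h : polyRep n τ (rowMonomial T) = ∏ k, columnMatrix T (τ k) k := by
      change MvPolynomial.rename τ (rowMonomial T) = _
      simp only [rowMonomial, map_prod, map_pow, MvPolynomial.rename_X]
      refine Finset.prod_congr rfl fun k _ => ?_
      rw [columnMatrix, Matrix.of_apply, if_pos (hτ k)]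
    rw [h]
    rcases Int.units_eq_one_or (Perm.sign τ) with h | h <;> simp [h]
  · obtain ⟨k, hk⟩ : ∃ k, T.colOf (τ k) ≠ T.colOf k := by
      by_contra! h
      exact hτ h
    rw [Finset.prod_eq_zero (Finset.mem_univ k), smul_zero]
    rw [columnMatrix, Matrix.of_apply, if_neg hk]

/-- The letters in column `j` are numbered by their rows. -/
noncomputable def Tab.columnEquiv (T : Tab n lam) (j : ℕ) :
    {k // T.colOf k = j} ≃ Fin (lam.colLen j) :=
  Equiv.ofBijective
    (fun k => ⟨T.rowOf k.1, YoungDiagram.mem_iff_lt_colLen.1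
      (lam.up_left_mem le_rfl k.2.ge (T.rowOf_colOf_mem k.1))⟩) (by
      constructor
      · intro k l h
        exact Subtype.ext (T.ext_rowOf_colOf (congrArg Fin.val h) (k.2.trans l.2.symm))
      · intro i
        obtain ⟨k, hr, hc⟩ := T.exists_rowOf_colOf (YoungDiagram.mem_iff_lt_colLen.2 i.2)
        exact ⟨⟨k, hc⟩, Fin.ext hr⟩)

theorem Tab.columnEquiv_val (T : Tab n lam) (j : ℕ) (k : {k // T.colOf k = j}) :
    (T.columnEquiv j k : ℕ) = T.rowOf k.1 := rfl

theorem spechtPoly_eq_prod_letters (T : Tab n lam) :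
    spechtPoly T = ∏ k, ∏ l with T.colOf l = T.colOf k ∧ T.rowOf l < T.rowOf k,
      (MvPolynomial.X k - MvPolynomial.X l) := by
  refine Fintype.prod_equiv T.entry _ _ fun p => Finset.prod_equiv T.entry ?_ fun _ _ => rfl
  intro q
  simp [Tab.rowOf, Tab.colOf]

/-- Numbering the letters of column `j` by row turns the block into a Vandermonde matrix. -/
theorem det_columnMatrix_block (T : Tab n lam) (j : ℕ) :
    ((columnMatrix T).toSquareBlock T.colOf j).det =
      ∏ k : {k // T.colOf k = j}, ∏ l with T.colOf l = T.colOf k ∧ T.rowOf l < T.rowOf k,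
        (MvPolynomial.X k.1 - MvPolynomial.X l : MvPolynomial (Fin n) ℂ) := by
  classical
  let e := T.columnEquiv j
  have h : ((columnMatrix T).toSquareBlock T.colOf j) = (Matrix.vandermonde fun i =>
      (MvPolynomial.X (e.symm i).1 : MvPolynomial (Fin n) ℂ)).submatrix e e := by
    ext1 k l
    simp [Matrix.toSquareBlock, Matrix.toSquareBlockProp, columnMatrix, Matrix.vandermonde, k.2,
      l.2, e, Tab.columnEquiv_val]
  -- The Vandermonde product has the lower index outside; exchange the products so that the upper
  -- letter is outside.
  rw [h, Matrix.det_submatrix_equiv_self, Matrix.det_vandermonde,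
    Finset.prod_comm' (t' := Finset.univ) (s' := fun i => Finset.Iio i) (by simp)]
  refine (Fintype.prod_equiv e _ _ fun k => ?_).symm
  refine Finset.prod_bij' (fun l hl => e ⟨l, (Finset.mem_filter.1 hl).2.1.trans k.2⟩)
    (fun i _ => (e.symm i).1) ?_ ?_ ?_ ?_ ?_
  · intro l hl
    exact Finset.mem_Iio.2 (Finset.mem_filter.1 hl).2.2
  · intro i hi
    refine Finset.mem_filter.2 ⟨Finset.mem_univ _, (e.symm i).2.trans k.2.symm, ?_⟩
    have h1 : (e (e.symm i) : ℕ) < e k := by simpa using Finset.mem_Iio.1 hi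
    exact h1
  · simp
  · simp
  · simp

theorem det_columnMatrix (T : Tab n lam) : (columnMatrix T).det = spechtPoly T := by
  classical
  have h : (columnMatrix T).BlockTriangular T.colOf := fun k l hlt => by
    rw [columnMatrix, Matrix.of_apply, if_neg hlt.ne']
  rw [h.det, spechtPoly_eq_prod_letters,
    ← Finset.prod_fiberwise_of_maps_to (t := Finset.univ.image T.colOf) (g := T.colOf) (by simp)]
  refine Finset.prod_congr rfl fun j _ => ?_
  rw [det_columnMatrix_block]
  exact (Finset.prod_subtype _ (by simp) fun k =>
    ∏ l with T.colOf l = T.colOf k ∧ T.rowOf l < T.rowOf k,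
      (MvPolynomial.X k - MvPolynomial.X l : MvPolynomial (Fin n) ℂ)).symm

theorem rowMonomial_eq_monomial (T : Tab n lam) :
    rowMonomial T = MvPolynomial.monomial (Finsupp.equivFunOnFinite.symm T.rowOf) 1 := by
  rw [rowMonomial, MvPolynomial.monomial_eq, Finsupp.prod_fintype _ _ (by simp)]
  simp

/-- The permutation module on tabloids embeds into the polynomials in such a way that polytabloids
are sent to Specht polynomials. -/
theorem exists_tabloid_map_spechtPoly (n : ℕ) (lam : YoungDiagram) :
    ∃ f : ℂ[Tabloid n lam] →ₗ[ℂ] MvPolynomial (Fin n) ℂ,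
      (∀ π x, f (tabloidRep n lam π x) = polyRep n π (f x)) ∧
      (∀ T, f (polytabloid T) = spechtPoly T) ∧ Function.Injective f := by
  let e : Tabloid n lam → (Fin n →₀ ℕ) := Quotient.lift
    (fun T => Finsupp.equivFunOnFinite.symm T.rowOf) fun T T' h => by rw [funext h]
  have he : Function.Injective e := by
    rintro ⟨T⟩ ⟨T'⟩ h
    exact Quotient.sound (s := rowSetoid n lam)
      (congrFun (Finsupp.equivFunOnFinite.symm.injective h))
  let w : Tabloid n lam → MvPolynomial (Fin n) ℂ := fun t => MvPolynomial.monomial (e t) 1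
  have hw : ∀ T : Tab n lam, w T.tabloid = rowMonomial T := fun T =>
    (rowMonomial_eq_monomial T).symm
  have hequi : ∀ (π : Perm (Fin n)) t, polyRep n π (w t) = w (π • t) := by
    rintro π ⟨T⟩
    change polyRep n π (w T.tabloid) = w (π • T).tabloid
    rw [hw, hw, polyRep_rowMonomial]
  refine ⟨tabloidLift w, tabloidLift_tabloidRep hequi, fun T => ?_, tabloidLift_injective ?_⟩
  · rw [polytabloid, map_asAlgebraHom_apply (tabloidLift_tabloidRep hequi), tabloidLift_single,
      one_smul, hw, asAlgebraHom_antisymmetrizer_rowMonomial, det_columnMatrix]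
  · simpa [w, Function.comp_def] using
      (MvPolynomial.basisMonomials (Fin n) ℂ).linearIndependent.comp e he

end SpechtPoly

/-! ### Transfer of spanning sets and isomorphisms from the Specht module. -/

section Isomorphisms

variable {n : ℕ} {lam : YoungDiagram} {W : Type*} [AddCommGroup W] [Module ℂ W]

theorem span_polytabloid_standard (n : ℕ) (lam : YoungDiagram) :
    Submodule.span ℂ (Set.range (polytabloid (n := n) (lam := lam))) = Submodule.span ℂ
      (Set.range fun T : {T : Tab n lam // T.IsStandard} => polytabloid T.1) := by
  refine le_antisymm (Submodule.span_le.2 ?_) (Submodule.span_mono ?_)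
  · rintro _ ⟨T, rfl⟩
    exact polytabloid_mem_span_standard T
  · rintro _ ⟨T, rfl⟩
    exact ⟨T.1, rfl⟩

/-- The image of the polytabloids under a linear map is spanned by the images of the standard
ones. -/
theorem span_map_polytabloid_standard {f : ℂ[Tabloid n lam] →ₗ[ℂ] W} {v : Tab n lam → W}
    (hfv : ∀ T, f (polytabloid T) = v T) :
    Submodule.span ℂ (Set.range v) = Submodule.span ℂ
      (Set.range fun T : {T : Tab n lam // T.IsStandard} => v T.1) := by
  have h := congrArg (Submodule.map f) (span_polytabloid_standard n lam)
  rw [Submodule.map_span, Submodule.map_span, ← Set.range_comp, ← Set.range_comp] at h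
  simpa only [Function.comp_def, hfv] using h

/-- A linear map is injective on the Specht module if the images of the standard polytabloids are
linearly independent. -/
theorem eq_zero_of_mem_spechtModule {f : ℂ[Tabloid n lam] →ₗ[ℂ] W} {v : Tab n lam → W}
    (hfv : ∀ T, f (polytabloid T) = v T)
    (hv : LinearIndependent ℂ fun T : {T : Tab n lam // T.IsStandard} => v T.1)
    {x : ℂ[Tabloid n lam]} (hx : x ∈ (spechtModule n lam).toSubmodule) (hfx : f x = 0) :
    x = 0 := by
  replace hx : x ∈ Submodule.span ℂ (Set.range (polytabloid (n := n) (lam := lam))) := hx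
  rw [span_polytabloid_standard, Finsupp.mem_span_range_iff_exists_finsupp] at hx
  obtain ⟨r, rfl⟩ := hx
  rw [Finsupp.sum, map_sum] at hfx
  simp only [map_smul, hfv] at hfx
  have hr : r = 0 := linearIndependent_iff.1 hv r hfx
  simp [hr]

theorem polytabloid_mem (T : Tab n lam) : polytabloid T ∈ (spechtModule n lam).toSubmodule :=
  Submodule.subset_span ⟨T, rfl⟩

/-- An equivariant map that is injective on the Specht module identifies it with the span of the
images of the polytabloids. -/
theorem exists_equiv_tabSpan {ρ : Representation ℂ (Perm (Fin n)) W} {v : Tab n lam → W}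
    (hv : ∀ π T, ρ π (v T) = v (π • T)) {f : ℂ[Tabloid n lam] →ₗ[ℂ] W}
    (hf : ∀ π x, f (tabloidRep n lam π x) = ρ π (f x)) (hfv : ∀ T, f (polytabloid T) = v T)
    (hinj : ∀ x ∈ (spechtModule n lam).toSubmodule, f x = 0 → x = 0) :
    ∃ φ : (spechtModule n lam).toRepresentation.Equiv (tabSpan ρ v hv).toRepresentation,
      ∀ T, φ ⟨polytabloid T, polytabloid_mem T⟩ = ⟨v T, Submodule.subset_span ⟨T, rfl⟩⟩ := by
  have hmap : (spechtModule n lam).toSubmodule.map f = (tabSpan ρ v hv).toSubmodule := by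
    change (Submodule.span ℂ (Set.range polytabloid)).map f = Submodule.span ℂ (Set.range v)
    rw [Submodule.map_span, ← Set.range_comp]
    simp only [Function.comp_def, hfv]
  let g := f.restrict (p := (spechtModule n lam).toSubmodule) (q := (tabSpan ρ v hv).toSubmodule)
    fun x hx => hmap ▸ Submodule.mem_map_of_mem hx
  have hg : Function.Bijective g := by
    constructor
    · rw [injective_iff_map_eq_zero]
      intro x hx
      exact Subtype.ext (hinj x.1 x.2 (congrArg Subtype.val hx))
    · rintro ⟨y, hy⟩
      rw [← hmap] at hy
      obtain ⟨x, hx, rfl⟩ := hy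
      exact ⟨⟨x, hx⟩, rfl⟩
  refine ⟨Representation.Equiv.mk (LinearEquiv.ofBijective g hg) fun π => ?_, fun T => ?_⟩
  · refine LinearMap.ext fun x => Subtype.ext ?_
    exact hf π x.1
  · exact Subtype.ext (hfv T)

end Isomorphisms

theorem proposition3p4 {n : ℕ} (lam : YoungDiagram) (sq : Fin n ≃ {p // p ∈ lam.cells})
    (c d : Fin n → ℕ) :
    (∀ (π : Equiv.Perm (Fin n)) (T : Tab n lam),
      diagonalRep n π (higherSpecht sq c d T) = higherSpecht sq c d (π • T)) ∧
    (∀ (T : Tab n lam) (a b t : ℕ), a < b → (t, b) ∈ lam →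
      (diagonalRep n).asAlgebraHom (garnirElement T a b t) (higherSpecht sq c d T) = 0) ∧
    (higherSpechtModule sq c d).toSubmodule =
      Submodule.span ℂ
        (Set.range fun T : {T : Tab n lam // T.IsStandard} => higherSpecht sq c d T.1) ∧
    (LinearIndependent ℂ
        (fun T : {T : Tab n lam // T.IsStandard} => higherSpecht sq c d T.1) →
      Nonempty ((higherSpechtModule sq c d).toRepresentation.Equiv
        (spechtModule n lam).toRepresentation) ∧
      ∃ (ψ : (higherSpechtModule sq c d).toRepresentation.Equiv
            (spechtPolyModule n lam).toRepresentation)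
        (B : Module.Basis {T : Tab n lam // T.IsStandard} ℂ
          (higherSpechtModule sq c d).toSubmodule)
        (B' : Module.Basis {T : Tab n lam // T.IsStandard} ℂ
          (spechtPolyModule n lam).toSubmodule),
        (∀ T : Tab n lam,
          ψ ⟨higherSpecht sq c d T, higherSpecht_mem sq c d T⟩ =
            ⟨spechtPoly T, spechtPoly_mem T⟩) ∧
        (∀ T, (B T : MvPolynomial (Fin n ⊕ Fin n) ℂ) = higherSpecht sq c d T.1) ∧
        (∀ T, (B' T : MvPolynomial (Fin n) ℂ) = spechtPoly T.1) ∧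
        ∀ T, ψ (B T) = B' T) := by
  obtain ⟨f, hf, hfv⟩ := exists_tabloid_map_higherSpecht sq c d
  have hspan : (higherSpechtModule sq c d).toSubmodule = Submodule.span ℂ
      (Set.range fun T : {T : Tab n lam // T.IsStandard} => higherSpecht sq c d T.1) :=
    span_map_polytabloid_standard hfv
  refine ⟨diagonalRep_higherSpecht sq c d, fun T a b t hab ht => ?_, hspan, fun hli => ?_⟩
  · rw [← hfv, ← map_asAlgebraHom_apply hf, garnirElement_polytabloid T hab ht, map_zero]
  · obtain ⟨g, hg, hgv, hginj⟩ := exists_tabloid_map_spechtPoly n lam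
    obtain ⟨φ, hφ⟩ := exists_equiv_tabSpan (diagonalRep_higherSpecht sq c d) hf hfv
      fun x hx => eq_zero_of_mem_spechtModule hfv hli hx
    -- Here injectivity holds on the whole permutation module, so no independence hypothesis enters.
    obtain ⟨χ, hχ⟩ := exists_equiv_tabSpan polyRep_spechtPoly hg hgv
      fun x _ hx => hginj (hx.trans (map_zero g).symm)
    let ψ : (higherSpechtModule sq c d).toRepresentation.Equiv
        (spechtPolyModule n lam).toRepresentation := φ.symm.trans χ
    have hψ : ∀ T : Tab n lam, ψ ⟨higherSpecht sq c d T, higherSpecht_mem sq c d T⟩ =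
        ⟨spechtPoly T, spechtPoly_mem T⟩ := by
      intro T
      have h := hφ T
      change χ (φ.symm _) = _
      refine Eq.trans ?_ (hχ T)
      rw [← Representation.Equiv.symm_apply_apply φ ⟨polytabloid T, polytabloid_mem T⟩, h]
      rfl
    let B : Module.Basis {T : Tab n lam // T.IsStandard} ℂ
        (higherSpechtModule sq c d).toSubmodule :=
      (Module.Basis.span hli).map (LinearEquiv.ofEq _ _ hspan.symm)
    have hB : ∀ T, B T = ⟨higherSpecht sq c d T.1, higherSpecht_mem sq c d T.1⟩ := by
      intro T
      refine Subtype.ext ?_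
      simp [B, Module.Basis.span_apply]
    have hB' : ∀ T, B.map ψ.toLinearEquiv T = ⟨spechtPoly T.1, spechtPoly_mem T.1⟩ := by
      intro T
      rw [Module.Basis.map_apply, hB]
      exact hψ T.1
    -- The Specht basis is the image of `B` under `ψ`, so its independence needs no separate proof.
    refine ⟨⟨φ.symm⟩, ψ, B, B.map ψ.toLinearEquiv, hψ, fun T => ?_, fun T => ?_, fun T => ?_⟩
    · rw [hB]
    · rw [hB']
    · rw [hB', hB, hψ]
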